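/- Let $V\in\ell^\infty(\mathbb Z,\mathbb R)$ be almost-periodic, i.e. for every $\varepsilon>0$ there is $R>0$ such that for every $k\in\mathbb Z$ there is $\ell\in\mathbb Z$ with $|k-\ell|\le R$ and $\|S^\ell V-V\|_\infty<\varepsilon$, where $(S^\ell V)(n)=V(n+\ell)$. Let $H$ be the discrete Schrödinger operator on $\ell^2(\mathbb Z)$ given by $(Hu)(n)=u(n-1)+u(n+1)+V(n)u(n)$, and let $P_N:\ell^2(\mathbb Z)\to\mathbb C^N$ be the projection onto the coordinates $0,\dots,N-1$. Then there is a unique Borel probability measure $dk$ on $\mathbb R$ (the density of states measure) such that $$\lim_{N\to\infty}\frac1N\operatorname{Tr}\bigl(P_N\,g(H)\,P_N^*\bigr)=\int g\,dk\qquad\text{for every bounded continuous } g:\mathbb R\to\mathbb R,$$ and its accumulation function, the integrated density of states $k(E)=\int\chi_{(-\infty,E]}\,dk$, is log-Hölder continuous: there is a constant $C>0$ such that $$|k(E_1)-k(E_2)|\le C\,\bigl(\log|E_1-E_2|^{-1}\bigr)^{-1}$$ for all $E_1,E_2\in\mathbb R$ with $|E_1-E_2|\le\tfrac12$ (for $E_1=E_2$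 the right-hand side is read as $0$). -/

import Mathlib

open Filter Topology MeasureTheory
open scoped lp ENNReal BoundedContinuousFunction

noncomputable section

namespace AlmostPeriodicSchrodinger

theorem memlp_comp_add {E : Type*} [NormedAddCommGroup E] {p : ℝ≥0∞} [Fact (1 ≤ p)]
    (k : ℤ) {f : ℤ → E} (hf : Memℓp f p) : Memℓp (fun n => f (n + k)) p := by
  rcases p.dichotomy with rfl | hp
  · rw [memℓp_infty_iff] at hf ⊢
    exact hf.mono (by rintro _ ⟨n, rfl⟩; exact ⟨n + k, rfl⟩)
  · have hp' : 0 < p.toReal := by linarith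
    rw [memℓp_gen_iff hp'] at hf ⊢
    exact hf.comp_injective (add_left_injective k)

/-- The `k`-th power of the shift on `ℓ^p(ℤ)`: `(S^k f)(n) = f (n + k)`. -/
def shift {E : Type*} [NormedAddCommGroup E] {p : ℝ≥0∞} [Fact (1 ≤ p)]
    (k : ℤ) (f : ℓ^p(ℤ, E)) : ℓ^p(ℤ, E) :=
  ⟨fun n => f (n + k), memlp_comp_add k (lp.memℓp f)⟩

@[simp]
theorem shift_apply {E : Type*} [NormedAddCommGroup E] {p : ℝ≥0∞} [Fact (1 ≤ p)]
    (k : ℤ) (f : ℓ^p(ℤ, E)) (n : ℤ) : shift k f n = f (n + k) := rfl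

theorem norm_shift_two (k : ℤ) (f : ℓ²(ℤ, ℂ)) : ‖shift k f‖ = ‖f‖ := by
  have h2 : (0 : ℝ) < (2 : ℝ≥0∞).toReal := by norm_num
  rw [lp.norm_eq_tsum_rpow h2, lp.norm_eq_tsum_rpow h2]
  congr 1
  exact (Equiv.addRight k).tsum_eq (fun n => ‖f n‖ ^ (2 : ℝ≥0∞).toReal)

/-- The shift `S^k` as a bounded operator on `ℓ²(ℤ)`. -/
def shiftOp (k : ℤ) : ℓ²(ℤ, ℂ) →L[ℂ] ℓ²(ℤ, ℂ) :=
  LinearMap.mkContinuous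
    { toFun := shift k
      map_add' := fun f g => by ext n; simp
      map_smul' := fun c f => by ext n; simp }
    1 (fun f => by simpa using (norm_shift_two k f).le)

/-- Multiplication by a bounded real sequence, as a bounded operator on `ℓ²(ℤ)`. -/
def mulOp (V : ℓ^∞(ℤ, ℝ)) : ℓ²(ℤ, ℂ) →L[ℂ] ℓ²(ℤ, ℂ) :=
  lp.mapCLM 2 (fun n => (V n : ℂ) • ContinuousLinearMap.id ℂ ℂ) (norm_nonneg V) (fun n => by
    simpa [norm_smul] using lp.norm_apply_le_norm (by simp) V n)

/-- The discrete Schrödinger operator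
`(H u)(n) = u(n - 1) + u(n + 1) + V(n) u(n)` on `ℓ²(ℤ)`. -/
def schrodinger (V : ℓ^∞(ℤ, ℝ)) : ℓ²(ℤ, ℂ) →L[ℂ] ℓ²(ℤ, ℂ) :=
  shiftOp (-1) + shiftOp 1 + mulOp V

theorem schrodinger_apply (V : ℓ^∞(ℤ, ℝ)) (u : ℓ²(ℤ, ℂ)) (n : ℤ) :
    schrodinger V u n = u (n - 1) + u (n + 1) + (V n : ℂ) * u n := rfl

theorem adjoint_shiftOp_inner (k : ℤ) (u v : ℓ²(ℤ, ℂ)) :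
    inner ℂ (shiftOp k u) v = inner ℂ u (shiftOp (-k) v) := by
  rw [lp.inner_eq_tsum, lp.inner_eq_tsum,
    ← (Equiv.addRight k).tsum_eq (fun n => inner ℂ (u n) (shiftOp (-k) v n))]
  refine tsum_congr fun n => ?_
  change inner ℂ (u (n + k)) (v n) = inner ℂ (u (n + k)) (v (n + k + -k))
  simp

theorem mulOp_inner (V : ℓ^∞(ℤ, ℝ)) (u v : ℓ²(ℤ, ℂ)) :
    inner ℂ (mulOp V u) v = inner ℂ u (mulOp V v) := by
  rw [lp.inner_eq_tsum, lp.inner_eq_tsum]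
  refine tsum_congr fun n => ?_
  change inner ℂ ((V n : ℂ) * u n) (v n) = inner ℂ (u n) ((V n : ℂ) * v n)
  simp
  ring

/-- The operator is self-adjoint, so its continuous functional calculus is the genuine one. -/
theorem isSelfAdjoint_schrodinger (V : ℓ^∞(ℤ, ℝ)) : IsSelfAdjoint (schrodinger V) := by
  rw [ContinuousLinearMap.isSelfAdjoint_iff_isSymmetric]
  intro u v
  change inner ℂ (shiftOp (-1) u + shiftOp 1 u + mulOp V u) v
    = inner ℂ u (shiftOp (-1) v + shiftOp 1 v + mulOp V v)
  simp only [inner_add_left, inner_add_right, adjoint_shiftOp_inner, mulOp_inner, neg_neg]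
  ring

/-- Almost-periodicity in the sense of Bohr: for every `ε > 0` the `ε`-almost periods of `V`
(with respect to the sup norm) are relatively dense in `ℤ`. -/
def IsAlmostPeriodic (V : ℓ^∞(ℤ, ℝ)) : Prop :=
  ∀ ε : ℝ, 0 < ε → ∃ R : ℝ, 0 < R ∧
    ∀ k : ℤ, ∃ l : ℤ, |((k - l : ℤ) : ℝ)| ≤ R ∧ ‖shift l V - V‖ < ε

/-- The coordinate projection `P_N : ℓ²(ℤ) → ℂ^N` onto the coordinates `0, …, N - 1`. -/
def coordProj (N : ℕ) : ℓ²(ℤ, ℂ) →L[ℂ] EuclideanSpace ℂ (Fin N) :=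
  (EuclideanSpace.equiv (Fin N) ℂ).symm.toContinuousLinearMap ∘L
    ContinuousLinearMap.pi (fun i : Fin N => lp.evalCLM ℂ (fun _ : ℤ => ℂ) 2 (i : ℤ))

theorem coordProj_apply (N : ℕ) (u : ℓ²(ℤ, ℂ)) (i : Fin N) :
    coordProj N u i = u ((i : ℕ) : ℤ) := rfl

/-- `g(A)` for a bounded operator `A` on a complex Hilbert space, by the continuous functional
calculus (the definition is used for self-adjoint `A` and continuous `g`). -/
def funcCalc {E : Type*} [NormedAddCommGroup E] [InnerProductSpace ℂ E] [CompleteSpace E]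
    (g : ℝ → ℝ) (A : E →L[ℂ] E) : E →L[ℂ] E :=
  cfc g A

/-- `(1 / N) Tr (P_N g(H) P_N^*)`, the integral of `g` against the finite-volume density of
states measure `dk_N`. -/
def finiteVolumeDOS (V : ℓ^∞(ℤ, ℝ)) (N : ℕ) (g : ℝ → ℝ) : ℂ :=
  (1 / (N : ℂ)) * LinearMap.trace ℂ (EuclideanSpace ℂ (Fin N))
    (coordProj N ∘L funcCalc g (schrodinger V) ∘L ContinuousLinearMap.adjoint (coordProj N) :
      EuclideanSpace ℂ (Fin N) →L[ℂ] EuclideanSpace ℂ (Fin N)).toLinearMap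

/-- `κ` is the density of states measure of `V`: the measures `dk_N`, given by
`∫ g dk_N = (1 / N) Tr (P_N g(H) P_N^*)` for continuous `g`, converge weakly to `κ`. -/
def IsDensityOfStates (V : ℓ^∞(ℤ, ℝ)) (κ : ProbabilityMeasure ℝ) : Prop :=
  ∀ g : ℝ →ᵇ ℝ, Tendsto (fun N : ℕ => finiteVolumeDOS V N g) atTop
    (𝓝 ((∫ x, g x ∂(κ : Measure ℝ) : ℝ) : ℂ))

/-- The accumulation function `k(E) = ∫ χ_{(-∞, E]} dκ` of a measure `κ`; for the density of
states measure this is the integrated density of states. -/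
def integratedDOS (κ : ProbabilityMeasure ℝ) (E : ℝ) : ℝ :=
  ∫ x, (Set.Iic E).indicator (fun _ => (1 : ℝ)) x ∂(κ : Measure ℝ)

end AlmostPeriodicSchrodinger

end

noncomputable section

namespace AlmostPeriodicSchrodinger

/-! Existence. The trace is the sum of the diagonal elements `⟨δ_n, g(H) δ_n⟩`, and translating the
site is the same as translating `V`. Since `A ↦ g(A)` is norm continuous on self-adjoint operators
with spectrum in a fixed compact set, these elements inherit relatively dense almost periods from
`V`, so their averages converge. The limit is a positive functional of `g` that sees only an
interval containing the spectrum, and Riesz representation turns it into a measure.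

Log-Hölder continuity. For restrictions of `H` to windows, the determinant `det(E - J) = ∏ (E -
λ_j)` cannot be small on every window close to `[0, N)`: four of these determinants are tied by a
Wronskian identity (`charDet_wronskian`), so one is at least `1/2` in modulus. Taking logarithms, `∑
log |E - λ_j| ≥ -log 2`, while each term is at most `log (2‖V‖ + 5)` for relevant `E`; hence the
number of eigenvalues within `d` of `E`, times `log d⁻¹`, is at most about `N log (2‖V‖ + 5)`.
Window eigenvalues and diagonal elements of `g(H)` have the same limiting averages
(`exists_abs_sum_eigenvalues_sub_le`), so the bound passes to `κ`. -/

/-! ### Characteristic determinants of finite windows -/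

/-- The restriction to the window `[a, a + n)` of the discrete Schrödinger operator with
potential `v`, as a real Jacobi matrix. -/
def jacobi (v : ℤ → ℝ) (a : ℤ) (n : ℕ) : Matrix (Fin n) (Fin n) ℝ :=
  Matrix.of fun i j => (if i = j then v (a + i) else 0) +
    (if (i : ℕ) + 1 = j then 1 else 0) + (if (j : ℕ) + 1 = i then 1 else 0)

theorem jacobi_apply (v : ℤ → ℝ) (a : ℤ) (n : ℕ) (i j : Fin n) :
    jacobi v a n i j = (if i = j then v (a + i) else 0) +
      (if (i : ℕ) + 1 = j then 1 else 0) + (if (j : ℕ) + 1 = i then 1 else 0) := rfl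

theorem isHermitian_jacobi (v : ℤ → ℝ) (a : ℤ) (n : ℕ) : (jacobi v a n).IsHermitian := by
  ext i j
  simp only [Matrix.conjTranspose_apply, jacobi_apply, star_trivial]
  by_cases h : i = j
  · subst h; ring
  · simp [h, Ne.symm h, add_comm]

/-- The characteristic determinant of the window `[a, a + n)` at energy `E`. -/
def charDet (v : ℤ → ℝ) (E : ℝ) (a : ℤ) (n : ℕ) : ℝ :=
  (Matrix.scalar (Fin n) E - jacobi v a n).det

theorem charDet_zero (v : ℤ → ℝ) (E : ℝ) (a : ℤ) : charDet v E a 0 = 1 := by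
  simp [charDet]

theorem charDet_one (v : ℤ → ℝ) (E : ℝ) (a : ℤ) : charDet v E a 1 = E - v a := by
  simp [charDet, jacobi_apply]

/-- Expansion of the determinant along its first row. -/
theorem charDet_add_two (v : ℤ → ℝ) (E : ℝ) (a : ℤ) (n : ℕ) :
    charDet v E a (n + 2) =
      (E - v a) * charDet v E (a + 1) (n + 1) - charDet v E (a + 2) n := by
  have hsub : (Matrix.scalar (Fin (n + 2)) E - jacobi v a (n + 2)).submatrix Fin.succ Fin.succ =
      Matrix.scalar (Fin (n + 1)) E - jacobi v (a + 1) (n + 1) := by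
    ext i j
    simp [jacobi_apply, Matrix.diagonal_apply, Fin.succ_inj, add_assoc, add_comm (1 : ℤ)]
  have hsub' : (Matrix.scalar (Fin (n + 2)) E - jacobi v a (n + 2)).submatrix
      (fun i : Fin n => i.succ.succ) (fun i : Fin n => i.succ.succ) =
      Matrix.scalar (Fin n) E - jacobi v (a + 2) n := by
    ext i j
    simp only [Matrix.submatrix_apply, Matrix.sub_apply, jacobi_apply, Matrix.scalar_apply,
      Matrix.diagonal_apply, Fin.succ_inj, Fin.val_succ, add_left_inj]
    push_cast
    rw [show a + ((i : ℤ) + 1 + 1) = a + 2 + i by ring]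
  -- Deleting row 0 and column 1 leaves a first column whose only nonzero entry is `-1`, at the top;
  -- what remains is the window starting at `a + 2`.
  have hminor : ((Matrix.scalar (Fin (n + 2)) E - jacobi v a (n + 2)).submatrix Fin.succ
      (Fin.succ 0 : Fin (n + 2)).succAbove).det = -charDet v E (a + 2) n := by
    rw [Matrix.det_succ_column_zero, Fin.sum_univ_succ, Finset.sum_eq_zero, add_zero]
    · rw [Matrix.submatrix_submatrix, charDet, ← hsub']
      have h1 : (Fin.succ 0 : Fin (n + 2)).succAbove ∘ Fin.succ = fun i : Fin n => i.succ.succ := by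
        ext i; simp [Fin.succAbove, Fin.lt_def]
      have h2 : Fin.succ ∘ (0 : Fin (n + 1)).succAbove = fun i : Fin n => i.succ.succ := by
        ext i; simp
      rw [h1, h2]
      simp [jacobi_apply]
    · intro i _
      simp [jacobi_apply, Fin.ext_iff]
  rw [charDet, Matrix.det_succ_row_zero, Fin.sum_univ_succ, Fin.sum_univ_succ,
    Finset.sum_eq_zero, add_zero]
  · rw [Fin.succAbove_zero, hsub, hminor, ← charDet]
    simp [jacobi_apply]
    ring
  · intro i _
    simp [jacobi_apply, Fin.ext_iff]

/-- The discrete Wronskian identity: transfer matrices are unimodular. -/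
theorem charDet_wronskian (v : ℤ → ℝ) (E : ℝ) (n : ℕ) : ∀ a : ℤ,
    charDet v E a (n + 2) * charDet v E (a + 1) n -
      charDet v E (a + 1) (n + 1) * charDet v E a (n + 1) = -1 := by
  induction n with
  | zero =>
    intro a
    rw [charDet_add_two]
    simp only [zero_add, charDet_zero, charDet_one]
    ring
  | succ n ih =>
    intro a
    have h := ih (a + 1)
    rw [charDet_add_two v E a (n + 1), charDet_add_two v E a n]
    rw [show a + 1 + 1 = a + 2 by ring] at h
    linear_combination h

/-- If all four determinants in the Wronskian identity were below `1/2` in modulus, the two products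
would each be below `1/4`, too small to differ by `1`. The windows differ from `[0, n + 2)` by at
most one site at either end. -/
theorem exists_half_le_abs_charDet (v : ℤ → ℝ) (E : ℝ) (n : ℕ) :
    ∃ (a m : ℕ), a ≤ 1 ∧ n + 1 ≤ a + m ∧ a + m ≤ n + 2 ∧ 1 / 2 ≤ |charDet v E a m| := by
  by_contra! h
  have h1 := h 0 (n + 2) (by omega) (by omega) (by omega)
  have h2 := h 1 n (by omega) (by omega) (by omega)
  have h3 := h 1 (n + 1) (by omega) (by omega) (by omega)
  have h4 := h 0 (n + 1) (by omega) (by omega) (by omega)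
  have hw := charDet_wronskian v E n 0
  simp only [Nat.cast_zero, Nat.cast_one, zero_add] at h1 h2 h3 h4 hw
  have h5 := mul_lt_mul'' h1 h2 (abs_nonneg _) (abs_nonneg _)
  have h6 := mul_lt_mul'' h3 h4 (abs_nonneg _) (abs_nonneg _)
  rw [← abs_mul] at h5 h6
  have h7 := abs_lt.1 h5
  have h8 := abs_lt.1 h6
  linarith [h7.1, h8.2]

/-! ### Bounds and eigenvalues for finite windows -/

theorem sum_ite_val_eq_le {n : ℕ} (k : ℕ) :
    ∑ j : Fin n, (if (j : ℕ) = k then (1 : ℝ) else 0) ≤ 1 := by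
  by_cases hk : k < n
  · rw [Finset.sum_eq_single (⟨k, hk⟩ : Fin n)] <;> simp [Fin.ext_iff]
  · rw [Finset.sum_eq_zero]
    · exact zero_le_one
    · intro j _
      rw [if_neg]; omega

theorem sum_abs_jacobi_le {v : ℤ → ℝ} {B : ℝ} (hv : ∀ n, |v n| ≤ B) (a : ℤ) (n : ℕ)
    (i : Fin n) : ∑ j, |jacobi v a n i j| ≤ B + 2 := by
  -- At `i = 0` the truncated `i - 1` equals `0`, which only enlarges the bound.
  have h1 : ∀ j, |jacobi v a n i j| ≤ (if i = j then B else 0) +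
      (if (j : ℕ) = i + 1 then 1 else 0) + (if (j : ℕ) = i - 1 then 1 else 0) := by
    intro j
    rw [jacobi_apply]
    refine (abs_add_le _ _).trans (add_le_add ((abs_add_le _ _).trans (add_le_add ?_ ?_)) ?_)
    · split_ifs <;> simp [hv]
    · split_ifs <;> first | omega | simp
    · split_ifs <;> first | omega | simp
  refine (Finset.sum_le_sum fun j _ => h1 j).trans ?_
  rw [Finset.sum_add_distrib, Finset.sum_add_distrib, Finset.sum_ite_eq]
  simp only [Finset.mem_univ, if_true]
  linarith [sum_ite_val_eq_le (n := n) (i + 1), sum_ite_val_eq_le (n := n) (i - 1)]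

/-- Iterating the absolute row-sum bound gives an estimate independent of the window size. -/
theorem abs_jacobi_pow_apply_le {v : ℤ → ℝ} {B : ℝ} (hB : 0 ≤ B) (hv : ∀ n, |v n| ≤ B) (a : ℤ)
    (n m : ℕ) (i j : Fin n) : |(jacobi v a n ^ m) i j| ≤ (B + 2) ^ m := by
  induction m generalizing i with
  | zero =>
    rw [pow_zero, pow_zero, Matrix.one_apply]
    split_ifs <;> simp
  | succ m ih =>
    rw [pow_succ', Matrix.mul_apply, pow_succ']
    refine (Finset.abs_sum_le_sum_abs _ _).trans ?_
    calc ∑ k, |jacobi v a n i k * (jacobi v a n ^ m) k j|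
        ≤ ∑ k, |jacobi v a n i k| * (B + 2) ^ m := by
          refine Finset.sum_le_sum fun k _ => ?_
          rw [abs_mul]
          exact mul_le_mul_of_nonneg_left (ih k) (abs_nonneg _)
      _ ≤ (B + 2) * (B + 2) ^ m := by
          rw [← Finset.sum_mul]
          exact mul_le_mul_of_nonneg_right (sum_abs_jacobi_le hv a n i) (by positivity)

/-- The eigenvalues of the window `[a, a + n)`. -/
def jacobiEigenvalues (v : ℤ → ℝ) (a : ℤ) (n : ℕ) : Fin n → ℝ :=
  (isHermitian_jacobi v a n).eigenvalues

/-- Gershgorin: an eigenvalue lies in a disc about a diagonal entry, with radius the rest of that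
row's absolute sum. -/
theorem abs_jacobiEigenvalues_le {v : ℤ → ℝ} {B : ℝ} (hv : ∀ n, |v n| ≤ B) (a : ℤ) (n : ℕ)
    (j : Fin n) : |jacobiEigenvalues v a n j| ≤ B + 2 := by
  have hev : Module.End.HasEigenvalue (Matrix.toLin' (jacobi v a n))
      (jacobiEigenvalues v a n j) := by
    apply Module.End.hasEigenvalue_of_hasEigenvector
      (x := WithLp.ofLp ((isHermitian_jacobi v a n).eigenvectorBasis j))
    rw [Module.End.hasEigenvector_iff, Module.End.mem_eigenspace_iff]
    refine ⟨?_, ?_⟩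
    · rw [Matrix.toLin'_apply, Matrix.IsHermitian.mulVec_eigenvectorBasis]
      rfl
    · intro h
      exact (isHermitian_jacobi v a n).eigenvectorBasis.toBasis.ne_zero j (by
        rw [OrthonormalBasis.coe_toBasis]
        ext i; exact congrFun h i)
  obtain ⟨k, hk⟩ := eigenvalue_mem_ball hev
  rw [Metric.mem_closedBall, Real.dist_eq] at hk
  have h2 := sum_abs_jacobi_le hv a n k
  rw [← Finset.add_sum_erase _ _ (Finset.mem_univ k)] at h2
  simp only [Real.norm_eq_abs] at hk
  have h3 := abs_sub_abs_le_abs_sub (jacobiEigenvalues v a n j) (jacobi v a n k k)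
  linarith

theorem charDet_eq_prod (v : ℤ → ℝ) (E : ℝ) (a : ℤ) (n : ℕ) :
    charDet v E a n = ∏ j, (E - jacobiEigenvalues v a n j) := by
  rw [charDet, ← Matrix.eval_charpoly, (isHermitian_jacobi v a n).charpoly_eq,
    Polynomial.eval_prod]
  simp [jacobiEigenvalues]

theorem trace_jacobi_pow (v : ℤ → ℝ) (a : ℤ) (n m : ℕ) :
    (jacobi v a n ^ m).trace = ∑ j, jacobiEigenvalues v a n j ^ m := by
  rw [(isHermitian_jacobi v a n).spectral_theorem, ← map_pow, Matrix.diagonal_pow,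
    Unitary.conjStarAlgAut_apply, Matrix.trace_mul_cycle, Unitary.coe_star_mul_self, one_mul,
    Matrix.trace_diagonal]
  rfl

/-- Away from the edges of its support, the Jacobi matrix acts as the difference operator. -/
theorem sum_jacobi_mul (v : ℤ → ℝ) (a : ℤ) (n : ℕ) (f : ℤ → ℂ) (hl : f (a - 1) = 0)
    (hr : f (a + n) = 0) (i : Fin n) :
    ∑ j, (jacobi v a n i j : ℂ) * f (a + j) =
      f (a + i - 1) + f (a + i + 1) + (v (a + i) : ℂ) * f (a + i) := by
  have h : ∀ j : Fin n, (jacobi v a n i j : ℂ) * f (a + j) =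
      (if i = j then (v (a + i) : ℂ) * f (a + j) else 0) +
      (if (i : ℕ) + 1 = j then f (a + j) else 0) + (if (j : ℕ) + 1 = i then f (a + j) else 0) := by
    intro j
    rw [jacobi_apply]
    push_cast
    split_ifs <;> simp <;> ring
  have h1 : ∑ j : Fin n, (if (i : ℕ) + 1 = j then f (a + j) else 0) = f (a + i + 1) := by
    by_cases hi : (i : ℕ) + 1 < n
    · rw [Finset.sum_eq_single (⟨i + 1, hi⟩ : Fin n)]
      · simp [add_assoc]
      · intro j _ hj
        rw [if_neg]
        intro h; exact hj (Fin.ext h.symm)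
      · simp
    · rw [Finset.sum_eq_zero]
      · have : (n : ℤ) = i + 1 := by have := i.2; omega
        rw [← hr, this, add_assoc]
      · intro j _
        rw [if_neg]; have := j.2; omega
  have h2 : ∑ j : Fin n, (if (j : ℕ) + 1 = i then f (a + j) else 0) = f (a + i - 1) := by
    by_cases hi : 0 < (i : ℕ)
    · rw [Finset.sum_eq_single (⟨i - 1, by omega⟩ : Fin n)]
      · rw [if_pos (by simp; omega)]
        congr 1
        simp only
        omega
      · intro j _ hj
        rw [if_neg]
        intro h; exact hj (Fin.ext (by simp; omega))
      · simp
    · rw [Finset.sum_eq_zero]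
      · have : ((i : ℕ) : ℤ) = 0 := by omega
        rw [← hl, this, add_zero]
      · intro j _
        rw [if_neg]; omega
  rw [Finset.sum_congr rfl fun j _ => h j, Finset.sum_add_distrib, Finset.sum_add_distrib, h1, h2,
    Finset.sum_ite_eq]
  simp only [Finset.mem_univ, if_true]
  ring

/-! ### Mean values of almost-periodic sequences -/

/-- Each unit step of the summation window exchanges one end term for another, at cost at most `2 *
M`. -/
theorem abs_sum_range_shift_sub_le {a : ℤ → ℝ} {M : ℝ} (hM : ∀ n, |a n| ≤ M) (n s : ℕ) (t : ℤ) :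
    |∑ j ∈ Finset.range n, a (j + (t + s)) - ∑ j ∈ Finset.range n, a (j + t)| ≤ 2 * M * s := by
  induction s with
  | zero => simp
  | succ s ih =>
    have h : ∑ j ∈ Finset.range n, a (j + (t + (s + 1 : ℕ))) -
        ∑ j ∈ Finset.range n, a (j + (t + s)) = a (n + (t + s)) - a (t + s) := by
      have := (Finset.sum_range_succ (fun j : ℕ => a (j + (t + s))) n).symm.trans
        (Finset.sum_range_succ' (fun j : ℕ => a (j + (t + s))) n)
      have h' : ∑ j ∈ Finset.range n, a (j + (t + (s + 1 : ℕ))) =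
          ∑ j ∈ Finset.range n, a ((j + 1 : ℕ) + (t + s)) := by
        refine Finset.sum_congr rfl fun j _ => congrArg a ?_
        push_cast; ring
      rw [h']
      simp only [Nat.cast_zero, zero_add] at this
      linarith
    have h1 := abs_le.1 (hM (n + (t + s)))
    have h2 := abs_le.1 (hM (t + s))
    rw [abs_le] at ih ⊢
    push_cast at h ⊢
    constructor <;> linarith [h1.1, h1.2, h2.1, h2.2, ih.1, ih.2]

theorem abs_sum_range_shift_sub_le' {a : ℤ → ℝ} {M : ℝ} (hM : ∀ n, |a n| ≤ M) (n : ℕ) (t : ℤ) :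
    |∑ j ∈ Finset.range n, a (j + t) - ∑ j ∈ Finset.range n, a j| ≤ 2 * M * |(t : ℝ)| := by
  obtain ⟨s, rfl | rfl⟩ := t.eq_nat_or_neg
  · simpa using abs_sum_range_shift_sub_le hM n s 0
  · have := abs_sum_range_shift_sub_le hM n s (-s)
    rw [abs_sub_comm]
    simpa using this

/-- A bounded sequence whose `ε`-almost periods are relatively dense has a mean value. -/
theorem exists_tendsto_average {a : ℤ → ℝ} {M : ℝ} (hM : ∀ n, |a n| ≤ M)
    (hap : ∀ ε : ℝ, 0 < ε → ∃ R : ℝ, ∀ k : ℤ, ∃ l : ℤ, |((k - l : ℤ) : ℝ)| ≤ R ∧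
      ∀ n, |a (n + l) - a n| ≤ ε) :
    ∃ c, Tendsto (fun N : ℕ => (∑ n ∈ Finset.range N, a n) / (N : ℝ)) atTop (𝓝 c) := by
  have hM0 : 0 ≤ M := (abs_nonneg _).trans (hM 0)
  set S : ℕ → ℝ := fun N => ∑ n ∈ Finset.range N, a n with hS
  have hSM : ∀ m n : ℕ, |S (m + n) - S m| ≤ M * n := by
    intro m n
    simp only [hS, Finset.sum_range_add, add_sub_cancel_left]
    refine (Finset.abs_sum_le_sum_abs _ _).trans ?_
    refine (Finset.sum_le_sum fun i _ => hM _).trans ?_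
    simp [mul_comm]
  -- The partial sums are nearly additive: replace the offset `m` by a nearby almost period `l`.
  -- Moving the window by `m - l` costs `2 * M * R`, and translating by `l` costs `ε` per term.
  have hquasi : ∀ ε : ℝ, 0 < ε → ∃ C : ℝ, ∀ m n : ℕ, |S (m + n) - S m - S n| ≤ ε * n + C := by
    intro ε hε
    obtain ⟨R, hR⟩ := hap ε hε
    refine ⟨2 * M * R, fun m n => ?_⟩
    obtain ⟨l, hl, hal⟩ := hR m
    have h1 := abs_sum_range_shift_sub_le' hM n (m - l)
    have h2 : |∑ j ∈ Finset.range n, a (m + j) - ∑ j ∈ Finset.range n, a (j + (m - l))|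
        ≤ ε * n := by
      rw [← Finset.sum_sub_distrib]
      refine (Finset.abs_sum_le_sum_abs _ _).trans ?_
      refine (Finset.sum_le_sum fun j _ => ?_).trans (b := ∑ j ∈ Finset.range n, ε) ?_
      · have := hal (j + (m - l))
        rwa [show (j : ℤ) + (m - l) + l = m + j by ring] at this
      · simp [mul_comm]
    have h3 : S (m + n) - S m = ∑ j ∈ Finset.range n, a (m + j) := by
      simp only [hS, Finset.sum_range_add, add_sub_cancel_left, Nat.cast_add]
    have h4 := mul_le_mul_of_nonneg_left hl (by positivity : 0 ≤ 2 * M)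
    rw [h3]
    rw [abs_le] at h1 h2 ⊢
    constructor <;> linarith [h1.1, h1.2, h2.1, h2.2]
  refine cauchySeq_tendsto_of_complete (Metric.cauchySeq_iff'.2 fun η hη => ?_)
  obtain ⟨C, hC⟩ := hquasi (η / 8) (by positivity)
  -- A block length that absorbs `C`: each appended block then has additivity error at most `η / 4 *
  -- L`.
  obtain ⟨L, hL0, hL⟩ : ∃ L : ℕ, 0 < L ∧ C ≤ η / 8 * L := by
    obtain ⟨L, hL⟩ := exists_nat_ge (C / (η / 8))
    refine ⟨L + 1, by omega, ?_⟩
    rw [div_le_iff₀ (by positivity)] at hL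
    push_cast
    nlinarith
  have hL0' : (0 : ℝ) < L := by exact_mod_cast hL0
  have hmul : ∀ q : ℕ, |S (q * L) - q * S L| ≤ q * (η / 4 * L) := by
    intro q
    induction q with
    | zero => simp [hS]
    | succ q ih =>
      have h1 := hC (q * L) L
      rw [show (q + 1) * L = q * L + L by ring]
      push_cast
      rw [abs_le] at h1 ih ⊢
      constructor <;> linarith [h1.1, h1.2, ih.1, ih.2]
  have hSL : |S L| ≤ M * L := by simpa [hS] using hSM 0 L
  have hkey : ∀ N : ℕ, |S N - N * (S L / L)| ≤ N * (η / 4) + 2 * M * L := by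
    intro N
    have hN : N / L * L + N % L = N := Nat.div_add_mod' N L
    have hr : ((N % L : ℕ) : ℝ) ≤ L := by exact_mod_cast (Nat.mod_lt N hL0).le
    have hNR : ((N / L : ℕ) : ℝ) * L + (N % L : ℕ) = N := by exact_mod_cast hN
    generalize (N / L) = q at hN hNR
    generalize (N % L) = r at hN hNR hr
    have h1 := hmul q
    have h2 := hSM (q * L) r
    rw [hN] at h2
    have h3 : (N : ℝ) * (S L / L) = q * S L + r / L * S L := by
      rw [← hNR]; field_simp
    have h4 : |(r : ℝ) / L * S L| ≤ M * L := by
      rw [abs_mul, abs_of_nonneg (by positivity : (0 : ℝ) ≤ r / L)]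
      calc (r : ℝ) / L * |S L| ≤ 1 * (M * L) := by
            apply mul_le_mul _ hSL (abs_nonneg _) zero_le_one
            rw [div_le_one hL0']; exact hr
        _ = M * L := one_mul _
    have h5 : M * r ≤ M * L := mul_le_mul_of_nonneg_left hr hM0
    have h6 : (q : ℝ) * (η / 4 * L) ≤ N * (η / 4) := by
      rw [← hNR]
      have : (0 : ℝ) ≤ r * (η / 4) := by positivity
      linarith
    rw [h3]
    rw [abs_le] at h1 h2 h4 ⊢
    constructor <;> linarith [h1.1, h1.2, h2.1, h2.2, h4.1, h4.2]
  -- Beyond `N₀` the incomplete block costs less than `η / 8`, so averages lie within `η / 4 + η /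
  -- 8` of `S L / L`, and within `3 * η / 4` of each other.
  obtain ⟨N₀, hN₀⟩ := exists_nat_gt (2 * M * L / (η / 8))
  have hN₀pos : (0 : ℝ) < N₀ := lt_of_le_of_lt (by positivity) hN₀
  have hfar : ∀ N : ℕ, N₀ ≤ N → |S N / N - S L / L| ≤ 3 * η / 8 := by
    intro N hN
    have hN' : (N₀ : ℝ) ≤ N := by exact_mod_cast hN
    have hNpos : (0 : ℝ) < N := hN₀pos.trans_le hN'
    rw [div_lt_iff₀ (by positivity)] at hN₀
    have h1 : S N / N - S L / L = (S N - N * (S L / L)) / N := by field_simp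
    rw [h1, abs_div, abs_of_pos hNpos, div_le_iff₀ hNpos]
    have h2 := hkey N
    nlinarith
  refine ⟨N₀, fun N hN => ?_⟩
  have h1 := hfar N hN
  have h2 := hfar N₀ le_rfl
  change |S N / N - S N₀ / N₀| < η
  rw [abs_le] at h1 h2
  rw [abs_lt]
  constructor <;> linarith [h1.1, h1.2, h2.1, h2.2]

/-! ### Functional calculus of self-adjoint operators -/

section FunctionalCalculus

variable {E : Type*} [NormedAddCommGroup E] [InnerProductSpace ℂ E] [CompleteSpace E]

theorem isSelfAdjoint_funcCalc (g : ℝ → ℝ) (A : E →L[ℂ] E) : IsSelfAdjoint (funcCalc g A) :=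
  cfc_predicate g A

theorem funcCalc_add {f g : ℝ → ℝ} (hf : Continuous f) (hg : Continuous g) (A : E →L[ℂ] E) :
    funcCalc (fun x => f x + g x) A = funcCalc f A + funcCalc g A :=
  cfc_add (a := A) f g hf.continuousOn hg.continuousOn

theorem funcCalc_const_mul (c : ℝ) {f : ℝ → ℝ} (hf : Continuous f) (A : E →L[ℂ] E) :
    funcCalc (fun x => c * f x) A = (c : ℂ) • funcCalc f A :=
  cfc_const_mul c f A hf.continuousOn

theorem re_inner_funcCalc_nonneg {f : ℝ → ℝ} (hf : ∀ x, 0 ≤ f x) (A : E →L[ℂ] E) (u : E) :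
    0 ≤ (inner ℂ u (funcCalc f A u)).re := by
  have h : 0 ≤ funcCalc f A := cfc_nonneg fun x _ => hf x
  rw [ContinuousLinearMap.nonneg_iff_isPositive] at h
  exact h.re_inner_nonneg_right u

theorem funcCalc_one {A : E →L[ℂ] E} (hA : IsSelfAdjoint A) : funcCalc (fun _ => 1) A = 1 :=
  cfc_const_one ℝ A hA

theorem funcCalc_pow {A : E →L[ℂ] E} (hA : IsSelfAdjoint A) (m : ℕ) :
    funcCalc (fun x => x ^ m) A = A ^ m :=
  cfc_pow_id A m hA

theorem spectrum_subset_Icc [Nontrivial E] {A : E →L[ℂ] E} {K : ℝ} (hK : ‖A‖ ≤ K) :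
    spectrum ℝ A ⊆ Set.Icc (-K) K := fun _ hx =>
  abs_le.1 ((spectrum.norm_le_norm_of_mem hx).trans hK)

theorem funcCalc_congr [Nontrivial E] {A : E →L[ℂ] E} {K : ℝ} (hK : ‖A‖ ≤ K) {f g : ℝ → ℝ}
    (h : Set.EqOn f g (Set.Icc (-K) K)) : funcCalc f A = funcCalc g A :=
  cfc_congr (h.mono (spectrum_subset_Icc hK))

theorem norm_funcCalc_le [Nontrivial E] {A : E →L[ℂ] E} {K : ℝ} (hK : ‖A‖ ≤ K) {f : ℝ → ℝ}
    {ε : ℝ} (hε : 0 ≤ ε) (h : ∀ x ∈ Set.Icc (-K) K, |f x| ≤ ε) : ‖funcCalc f A‖ ≤ ε :=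
  norm_cfc_le hε fun x hx => h x (spectrum_subset_Icc hK hx)

theorem exists_norm_funcCalc_sub_lt [Nontrivial E] {A : E →L[ℂ] E} (hA : IsSelfAdjoint A)
    {g : ℝ → ℝ} (hg : Continuous g) {ε : ℝ} (hε : 0 < ε) :
    ∃ η > 0, ∀ B : E →L[ℂ] E, IsSelfAdjoint B → ‖B - A‖ < η →
      ‖funcCalc g B - funcCalc g A‖ < ε := by
  have hc := (continuousOn_cfc (E →L[ℂ] E) (isCompact_Icc (a := -(‖A‖ + 1)) (b := ‖A‖ + 1)) g
    hg.continuousOn).continuousWithinAt (x := A) ⟨hA, spectrum_subset_Icc (by linarith)⟩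
  obtain ⟨η, hη, h⟩ := Metric.continuousWithinAt_iff.1 hc ε hε
  -- The cap `1` keeps the spectrum of `B` in the compact interval on which continuity of the
  -- calculus was invoked.
  refine ⟨min η 1, by positivity, fun B hB hBA => ?_⟩
  have h1 := norm_le_norm_add_norm_sub' B A
  have h2 := h (x := B) ⟨hB, spectrum_subset_Icc (by linarith [min_le_right η 1])⟩
    (by rw [dist_eq_norm]; exact hBA.trans_le (min_le_left _ _))
  rwa [dist_eq_norm] at h2

theorem funcCalc_conj_unitary {A : E →L[ℂ] E} (hA : IsSelfAdjoint A) {U : E →L[ℂ] E}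
    (hU : U ∈ unitary (E →L[ℂ] E)) {g : ℝ → ℝ} (hg : Continuous g) :
    funcCalc g (U * A * star U) = U * funcCalc g A * star U := by
  let φ := Unitary.conjStarAlgAut ℂ (E →L[ℂ] E) ⟨U, hU⟩
  have hc : Continuous φ := by
    change Continuous fun A => U * A * star U
    fun_prop
  have hsa : IsSelfAdjoint (φ A) := hA.map φ
  exact (StarAlgHomClass.map_cfc (S := ℂ) φ g A hg.continuousOn hc hA hsa).symm

end FunctionalCalculus

/-! ### Diagonal matrix elements and translation covariance -/

/-- The standard basis vector of `ℓ²(ℤ)` at the site `n`. -/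
def delta (n : ℤ) : ℓ²(ℤ, ℂ) := lp.single 2 n (1 : ℂ)

theorem norm_delta (n : ℤ) : ‖delta n‖ = 1 := by
  rw [delta, lp.norm_single (by norm_num)]; simp

theorem delta_apply (n k : ℤ) : delta n k = if k = n then 1 else 0 := by
  rw [delta, lp.coeFn_single, Pi.single_apply]

theorem inner_delta_left (n : ℤ) (u : ℓ²(ℤ, ℂ)) : inner ℂ (delta n) u = u n := by
  rw [delta, lp.inner_single_left]
  simp

theorem norm_apply_le (u : ℓ²(ℤ, ℂ)) (n : ℤ) : ‖u n‖ ≤ ‖u‖ :=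
  lp.norm_apply_le_norm (by norm_num) u n

theorem norm_clm_delta_apply_le (A : ℓ²(ℤ, ℂ) →L[ℂ] ℓ²(ℤ, ℂ)) (n k : ℤ) :
    ‖A (delta n) k‖ ≤ ‖A‖ := by
  refine (norm_apply_le _ _).trans ((A.le_opNorm _).trans ?_)
  rw [norm_delta, mul_one]

theorem abs_potential_le (V : ℓ^∞(ℤ, ℝ)) (n : ℤ) : |V n| ≤ ‖V‖ :=
  lp.norm_apply_le_norm (by simp) V n

theorem norm_schrodinger_le (V : ℓ^∞(ℤ, ℝ)) : ‖schrodinger V‖ ≤ ‖V‖ + 2 := by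
  have h1 : ∀ k, ‖shiftOp k‖ ≤ 1 := fun k => LinearMap.mkContinuous_norm_le _ zero_le_one _
  have h2 : ‖mulOp V‖ ≤ ‖V‖ := lp.norm_mapCLM_le _ _ (norm_nonneg _) _
  have h3 := norm_add₃_le (a := shiftOp (-1)) (b := shiftOp 1) (c := mulOp V)
  rw [schrodinger]
  linarith [h1 1, h1 (-1)]

theorem norm_schrodinger_sub_le (V W : ℓ^∞(ℤ, ℝ)) :
    ‖schrodinger V - schrodinger W‖ ≤ ‖V - W‖ := by
  have : schrodinger V - schrodinger W = mulOp (V - W) := by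
    ext u n
    change (schrodinger V u n) - (schrodinger W u n) = ((V n - W n : ℝ) : ℂ) * u n
    rw [schrodinger_apply, schrodinger_apply]
    push_cast
    ring
  rw [this]
  exact lp.norm_mapCLM_le _ _ (norm_nonneg _) _

instance : Nontrivial ℓ²(ℤ, ℂ) :=
  ⟨⟨delta 0, 0, fun h => by simpa [h] using norm_delta 0⟩⟩

/-- The diagonal matrix element `⟨δ_n, g(H) δ_n⟩`. -/
def localDOS (V : ℓ^∞(ℤ, ℝ)) (g : ℝ → ℝ) (n : ℤ) : ℝ :=
  (funcCalc g (schrodinger V) (delta n) n).re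

theorem ofReal_localDOS (V : ℓ^∞(ℤ, ℝ)) (g : ℝ → ℝ) (n : ℤ) :
    (localDOS V g n : ℂ) = funcCalc g (schrodinger V) (delta n) n := by
  have hsa := isSelfAdjoint_funcCalc g (schrodinger V)
  rw [ContinuousLinearMap.isSelfAdjoint_iff_isSymmetric] at hsa
  have h := hsa.coe_re_inner_self_apply (delta n)
  simp only [ContinuousLinearMap.coe_coe, inner_delta_left] at h
  exact h

/-- The adjoint of the coordinate projection sends the standard basis to the `delta` vectors, and
the diagonal elements are real because `g(H)` is self-adjoint. -/
theorem finiteVolumeDOS_eq (V : ℓ^∞(ℤ, ℝ)) (N : ℕ) (g : ℝ → ℝ) :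
    finiteVolumeDOS V N g =
      (((∑ n ∈ Finset.range N, localDOS V g n) / (N : ℝ) : ℝ) : ℂ) := by
  have hadj : ∀ i : Fin N, ContinuousLinearMap.adjoint (coordProj N)
      (EuclideanSpace.basisFun (Fin N) ℂ i) = delta ((i : ℕ) : ℤ) := by
    intro i
    refine ext_inner_right ℂ fun u => ?_
    rw [ContinuousLinearMap.adjoint_inner_left, inner_delta_left,
      ← OrthonormalBasis.repr_apply_apply, EuclideanSpace.basisFun_repr, coordProj_apply]
  rw [finiteVolumeDOS, LinearMap.trace_eq_sum_inner _ (EuclideanSpace.basisFun (Fin N) ℂ)]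
  push_cast
  rw [one_div, div_eq_inv_mul, Finset.sum_range]
  congr 1
  refine Finset.sum_congr rfl fun i _ => ?_
  rw [ofReal_localDOS, ← OrthonormalBasis.repr_apply_apply, EuclideanSpace.basisFun_repr]
  change coordProj N (funcCalc g (schrodinger V) (ContinuousLinearMap.adjoint (coordProj N)
      (EuclideanSpace.basisFun (Fin N) ℂ i))) i = _
  rw [hadj, coordProj_apply]

theorem localDOS_add (V : ℓ^∞(ℤ, ℝ)) {f g : ℝ → ℝ} (hf : Continuous f) (hg : Continuous g)
    (n : ℤ) : localDOS V (fun x => f x + g x) n = localDOS V f n + localDOS V g n := by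
  rw [localDOS, funcCalc_add hf hg]
  exact Complex.add_re _ _

theorem localDOS_const_mul (V : ℓ^∞(ℤ, ℝ)) (c : ℝ) {f : ℝ → ℝ} (hf : Continuous f)
    (n : ℤ) : localDOS V (fun x => c * f x) n = c * localDOS V f n := by
  rw [localDOS, funcCalc_const_mul c hf]
  exact Complex.re_ofReal_mul _ _

theorem localDOS_nonneg (V : ℓ^∞(ℤ, ℝ)) {f : ℝ → ℝ} (hf : ∀ x, 0 ≤ f x) (n : ℤ) :
    0 ≤ localDOS V f n := by
  have := re_inner_funcCalc_nonneg hf (schrodinger V) (delta n)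
  rwa [inner_delta_left] at this

theorem localDOS_congr (V : ℓ^∞(ℤ, ℝ)) {f g : ℝ → ℝ}
    (h : Set.EqOn f g (Set.Icc (-(‖V‖ + 2)) (‖V‖ + 2))) (n : ℤ) :
    localDOS V f n = localDOS V g n := by
  rw [localDOS, localDOS, funcCalc_congr (norm_schrodinger_le V) h]

theorem localDOS_one (V : ℓ^∞(ℤ, ℝ)) (n : ℤ) : localDOS V (fun _ => 1) n = 1 := by
  rw [localDOS, funcCalc_one (isSelfAdjoint_schrodinger V), one_apply_eq_self, delta_apply]
  simp

theorem localDOS_pow (V : ℓ^∞(ℤ, ℝ)) (m : ℕ) (n : ℤ) :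
    localDOS V (fun x => x ^ m) n = ((schrodinger V ^ m) (delta n) n).re := by
  rw [localDOS, funcCalc_pow (isSelfAdjoint_schrodinger V)]

theorem abs_localDOS_le_norm (V : ℓ^∞(ℤ, ℝ)) (f : ℝ → ℝ) (n : ℤ) :
    |localDOS V f n| ≤ ‖funcCalc f (schrodinger V)‖ :=
  (Complex.abs_re_le_norm _).trans (norm_clm_delta_apply_le _ _ _)

theorem abs_localDOS_le (V : ℓ^∞(ℤ, ℝ)) {f : ℝ → ℝ} {ε : ℝ} (hε : 0 ≤ ε)
    (h : ∀ x ∈ Set.Icc (-(‖V‖ + 2)) (‖V‖ + 2), |f x| ≤ ε) (n : ℤ) : |localDOS V f n| ≤ ε :=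
  (abs_localDOS_le_norm V f n).trans (norm_funcCalc_le (norm_schrodinger_le V) hε h)

theorem shiftOp_apply (k : ℤ) (u : ℓ²(ℤ, ℂ)) (n : ℤ) : shiftOp k u n = u (n + k) := rfl

theorem star_shiftOp (k : ℤ) : star (shiftOp k) = shiftOp (-k) := by
  rw [ContinuousLinearMap.star_eq_adjoint, eq_comm, ContinuousLinearMap.eq_adjoint_iff]
  intro u v
  rw [adjoint_shiftOp_inner, neg_neg]

theorem shiftOp_mul_shiftOp_neg (k : ℤ) : shiftOp k * shiftOp (-k) = 1 := by
  ext u n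
  rw [mul_apply_eq_comp, shiftOp_apply, shiftOp_apply, one_apply_eq_self]
  rw [add_neg_cancel_right]

theorem shiftOp_mem_unitary (k : ℤ) :
    shiftOp k ∈ unitary (ℓ²(ℤ, ℂ) →L[ℂ] ℓ²(ℤ, ℂ)) := by
  rw [Unitary.mem_iff, star_shiftOp]
  exact ⟨by simpa using shiftOp_mul_shiftOp_neg (-k), shiftOp_mul_shiftOp_neg k⟩

theorem schrodinger_shift (V : ℓ^∞(ℤ, ℝ)) (l : ℤ) :
    schrodinger (shift l V) = shiftOp l * schrodinger V * shiftOp (-l) := by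
  ext u n
  change _ = schrodinger V (shiftOp (-l) u) (n + l)
  simp only [schrodinger_apply, shiftOp_apply, shift_apply]
  rw [show n + l - 1 + -l = n - 1 by ring, show n + l + 1 + -l = n + 1 by ring,
    add_neg_cancel_right]

/-- Translating the potential conjugates `H` by a unitary shift, and the functional calculus
commutes with unitary conjugation. -/
theorem localDOS_shift (V : ℓ^∞(ℤ, ℝ)) (l : ℤ) {g : ℝ → ℝ} (hg : Continuous g) (n : ℤ) :
    localDOS (shift l V) g n = localDOS V g (n + l) := by
  have h : shiftOp (-l) (delta n) = delta (n + l) := by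
    ext k
    rw [shiftOp_apply, delta_apply, delta_apply]
    congr 1
    rw [eq_iff_iff]
    omega
  rw [localDOS, schrodinger_shift, ← star_shiftOp,
    funcCalc_conj_unitary (isSelfAdjoint_schrodinger V) (shiftOp_mem_unitary l) hg, star_shiftOp,
    localDOS, ← h]
  rfl

/-- For an almost-periodic potential the finite-volume averages of the local density of states
converge. -/
theorem exists_tendsto_average_localDOS {V : ℓ^∞(ℤ, ℝ)} (hV : IsAlmostPeriodic V) {g : ℝ → ℝ}
    (hg : Continuous g) : ∃ c, Tendsto
      (fun N : ℕ => (∑ n ∈ Finset.range N, localDOS V g n) / (N : ℝ)) atTop (𝓝 c) := by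
  refine exists_tendsto_average (M := ‖funcCalc g (schrodinger V)‖)
    (abs_localDOS_le_norm V g) fun ε hε => ?_
  -- Every `η`-almost period of `V` is an `ε`-almost period of `n ↦ localDOS V g n`, by continuity
  -- of `A ↦ g(A)` and covariance.
  obtain ⟨η, hη, h⟩ := exists_norm_funcCalc_sub_lt (isSelfAdjoint_schrodinger V) hg hε
  obtain ⟨R, -, hR⟩ := hV η hη
  refine ⟨R, fun k => ?_⟩
  obtain ⟨l, hl, hlV⟩ := hR k
  refine ⟨l, hl, fun n => ?_⟩
  rw [← localDOS_shift V l hg]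
  have h1 : localDOS (shift l V) g n - localDOS V g n =
      ((funcCalc g (schrodinger (shift l V)) - funcCalc g (schrodinger V)) (delta n) n).re := by
    rw [sub_apply]
    exact (Complex.sub_re _ _).symm
  rw [h1]
  exact (Complex.abs_re_le_norm _).trans ((norm_clm_delta_apply_le _ _ _).trans (h _
    (isSelfAdjoint_schrodinger _) ((norm_schrodinger_sub_le _ _).trans_lt hlV)).le)

/-! ### The density of states measure -/

theorem isDensityOfStates_iff (V : ℓ^∞(ℤ, ℝ)) (κ : ProbabilityMeasure ℝ) :
    IsDensityOfStates V κ ↔ ∀ g : ℝ →ᵇ ℝ, Tendsto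
      (fun N : ℕ => (∑ n ∈ Finset.range N, localDOS V g n) / (N : ℝ)) atTop
      (𝓝 (∫ x, g x ∂(κ : Measure ℝ))) := by
  refine forall_congr' fun g => ?_
  simp_rw [finiteVolumeDOS_eq]
  exact tendsto_ofReal_iff

/-- The mean of the local density of states, `lim (1 / N) Tr (P_N g(H) P_N^*)`. -/
def meanDOS (V : ℓ^∞(ℤ, ℝ)) (g : ℝ → ℝ) : ℝ :=
  limUnder atTop fun N : ℕ => (∑ n ∈ Finset.range N, localDOS V g n) / (N : ℝ)

theorem tendsto_meanDOS {V : ℓ^∞(ℤ, ℝ)} (hV : IsAlmostPeriodic V) {g : ℝ → ℝ}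
    (hg : Continuous g) : Tendsto
      (fun N : ℕ => (∑ n ∈ Finset.range N, localDOS V g n) / (N : ℝ)) atTop (𝓝 (meanDOS V g)) :=
  tendsto_nhds_limUnder (exists_tendsto_average_localDOS hV hg)

theorem meanDOS_congr (V : ℓ^∞(ℤ, ℝ)) {f g : ℝ → ℝ}
    (h : Set.EqOn f g (Set.Icc (-(‖V‖ + 2)) (‖V‖ + 2))) : meanDOS V f = meanDOS V g := by
  simp only [meanDOS, localDOS_congr V h]

theorem meanDOS_add {V : ℓ^∞(ℤ, ℝ)} (hV : IsAlmostPeriodic V) {f g : ℝ → ℝ}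
    (hf : Continuous f) (hg : Continuous g) :
    meanDOS V (fun x => f x + g x) = meanDOS V f + meanDOS V g := by
  refine tendsto_nhds_unique (tendsto_meanDOS hV (hf.add hg)) ?_
  refine ((tendsto_meanDOS hV hf).add (tendsto_meanDOS hV hg)).congr fun N => ?_
  rw [← add_div, ← Finset.sum_add_distrib]
  simp only [localDOS_add V hf hg]

theorem meanDOS_const_mul {V : ℓ^∞(ℤ, ℝ)} (hV : IsAlmostPeriodic V) (c : ℝ) {f : ℝ → ℝ}
    (hf : Continuous f) : meanDOS V (fun x => c * f x) = c * meanDOS V f := by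
  refine tendsto_nhds_unique (tendsto_meanDOS hV (continuous_const.mul hf)) ?_
  refine ((tendsto_meanDOS hV hf).const_mul c).congr fun N => ?_
  rw [mul_div_assoc', Finset.mul_sum]
  simp only [localDOS_const_mul V c hf]

theorem meanDOS_nonneg {V : ℓ^∞(ℤ, ℝ)} (hV : IsAlmostPeriodic V) {f : ℝ → ℝ}
    (hf : Continuous f) (h : ∀ x, 0 ≤ f x) : 0 ≤ meanDOS V f :=
  ge_of_tendsto' (tendsto_meanDOS hV hf) fun N =>
    div_nonneg (Finset.sum_nonneg fun n _ => localDOS_nonneg V h n) N.cast_nonneg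

theorem meanDOS_one {V : ℓ^∞(ℤ, ℝ)} (hV : IsAlmostPeriodic V) : meanDOS V (fun _ => 1) = 1 := by
  refine tendsto_nhds_unique (tendsto_meanDOS hV continuous_const) ?_
  refine tendsto_const_nhds.congr' ?_
  filter_upwards [eventually_gt_atTop 0] with N hN
  simp only [localDOS_one, Finset.sum_const, Finset.card_range, nsmul_eq_mul, mul_one]
  rw [div_self (by exact_mod_cast hN.ne')]

theorem neg_norm_add_two_le (V : ℓ^∞(ℤ, ℝ)) : -(‖V‖ + 2) ≤ ‖V‖ + 2 := by
  linarith [norm_nonneg V]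

open scoped CompactlySupported in
/-- The density of states as a positive functional on continuous functions on an interval
containing the spectrum. -/
def dosFunctional {V : ℓ^∞(ℤ, ℝ)} (hV : IsAlmostPeriodic V) :
    C_c(Set.Icc (-(‖V‖ + 2)) (‖V‖ + 2), ℝ) →ₚ[ℝ] ℝ :=
  PositiveLinearMap.mk₀
    { toFun := fun f => meanDOS V (Set.IccExtend (neg_norm_add_two_le V) f)
      map_add' := fun f g => meanDOS_add hV f.continuous.Icc_extend' g.continuous.Icc_extend'
      map_smul' := fun c f => meanDOS_const_mul hV c f.continuous.Icc_extend' }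
    fun f hf => meanDOS_nonneg hV f.continuous.Icc_extend' fun _ => hf _

/-- The Riesz measure lives on the interval and is pushed forward to `ℝ`. How a function is extended
off the interval is immaterial, since the interval contains the spectrum; total mass one comes from
`g = 1`. -/
theorem exists_isDensityOfStates {V : ℓ^∞(ℤ, ℝ)} (hV : IsAlmostPeriodic V) :
    ∃ κ : ProbabilityMeasure ℝ, IsDensityOfStates V κ := by
  let μ := RealRMK.rieszMeasure (dosFunctional hV)
  have h_integral : ∀ g : ℝ → ℝ, Continuous g → ∫ x, g x ∂(μ.map Subtype.val) = meanDOS V g := by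
    intro g hg
    have hgX : Continuous fun x : Set.Icc (-(‖V‖ + 2)) (‖V‖ + 2) => g x :=
      hg.comp continuous_subtype_val
    rw [integral_map measurable_subtype_coe.aemeasurable hg.aestronglyMeasurable]
    refine (RealRMK.integral_rieszMeasure (dosFunctional hV)
      ⟨⟨_, hgX⟩, HasCompactSupport.of_compactSpace _⟩).trans ?_
    exact meanDOS_congr V fun x hx => Set.IccExtend_of_mem _ _ hx
  have hfin : IsFiniteMeasure (μ.map Subtype.val) := by
    have : IsFiniteMeasure μ := inferInstance
    infer_instance
  have hprob : IsProbabilityMeasure (μ.map Subtype.val) := by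
    have h := h_integral (fun _ => 1) continuous_const
    rw [meanDOS_one hV, integral_const, smul_eq_mul, mul_one] at h
    refine ⟨?_⟩
    rwa [measureReal_def, ENNReal.toReal_eq_one_iff] at h
  refine ⟨⟨_, hprob⟩, (isDensityOfStates_iff V _).2 fun g => ?_⟩
  rw [ProbabilityMeasure.coe_mk, h_integral g g.continuous]
  exact tendsto_meanDOS hV g.continuous

theorem IsDensityOfStates.eq {V : ℓ^∞(ℤ, ℝ)} {κ κ' : ProbabilityMeasure ℝ}
    (h : IsDensityOfStates V κ) (h' : IsDensityOfStates V κ') : κ = κ' := by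
  rw [isDensityOfStates_iff] at h h'
  have : (κ : Measure ℝ) = κ' := ext_of_forall_integral_eq_of_IsFiniteMeasure fun g =>
    tendsto_nhds_unique (h g) (h' g)
  exact Subtype.ext this

/-! ### Comparing window eigenvalues with the full-line operator -/

theorem schrodinger_pow_succ_apply (V : ℓ^∞(ℤ, ℝ)) (p : ℕ) (u : ℓ²(ℤ, ℂ)) (k : ℤ) :
    (schrodinger V ^ (p + 1)) u k = (schrodinger V ^ p) u (k - 1) +
      (schrodinger V ^ p) u (k + 1) + (V k : ℂ) * (schrodinger V ^ p) u k := by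
  rw [pow_succ', mul_apply_eq_comp, schrodinger_apply]

/-- Powers of the Schrödinger operator have finite range. -/
theorem schrodinger_pow_delta_eq_zero (V : ℓ^∞(ℤ, ℝ)) (p : ℕ) (n k : ℤ) (h : (p : ℤ) < |k - n|) :
    (schrodinger V ^ p) (delta n) k = 0 := by
  induction p generalizing k with
  | zero =>
    rw [pow_zero, one_apply_eq_self, delta_apply, if_neg]
    rintro rfl
    simp at h
  | succ p ih =>
    rw [schrodinger_pow_succ_apply, ih, ih, ih] <;> first | simp | grind

/-- Away from the boundary of a window, powers of the Jacobi matrix and of the full operator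
have the same matrix elements. -/
theorem jacobi_pow_apply_eq (V : ℓ^∞(ℤ, ℝ)) (a : ℤ) (m p : ℕ) (i : Fin m) (h1 : p ≤ i)
    (h2 : i + p < m) (j : Fin m) :
    ((jacobi V a m ^ p) j i : ℂ) = (schrodinger V ^ p) (delta (a + i)) (a + j) := by
  induction p generalizing j with
  | zero =>
    rw [pow_zero, pow_zero, one_apply_eq_self, delta_apply, Matrix.one_apply]
    simp only [add_right_inj, Nat.cast_inj, Fin.ext_iff]
    split_ifs <;> simp
  | succ p ih =>
    -- By finite range, `H ^ p δ` vanishes at the sites just outside the window, so truncating `H`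
    -- to the window loses nothing at this step.
    rw [schrodinger_pow_succ_apply, ← sum_jacobi_mul V a m (fun k => (schrodinger V ^ p)
      (delta (a + i)) k), pow_succ', Matrix.mul_apply]
    · rw [Complex.ofReal_sum]
      simp only [Complex.ofReal_mul]
      exact Finset.sum_congr rfl fun k _ => by rw [ih (by omega) (by omega)]
    · refine schrodinger_pow_delta_eq_zero _ _ _ _ ?_
      rw [show a - 1 - (a + i) = -((i : ℤ) + 1) by ring, abs_neg, abs_of_nonneg (by positivity)]
      omega
    · refine schrodinger_pow_delta_eq_zero _ _ _ _ ?_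
      rw [show a + m - (a + i) = (m : ℤ) - i by ring]
      exact lt_of_lt_of_le (by omega) (le_abs_self _)

/-- At most `p` sites at each end are too close to the boundary for the `p`-th powers to be known to
agree. -/
theorem sum_boundary_le (m p : ℕ) {c : ℝ} (hc : 0 ≤ c) :
    ∑ i ∈ Finset.range m, (if p ≤ i ∧ i + p < m then 0 else c) ≤ 2 * p * c := by
  have h : ∀ i ∈ Finset.range m, (if p ≤ i ∧ i + p < m then 0 else c) ≤
      (if i ∈ Finset.range p then c else 0) + (if i ∈ Finset.Ico (m - p) m then c else 0) := by
    intro i hi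
    simp only [Finset.mem_range, Finset.mem_Ico] at hi ⊢
    split_ifs <;> first | omega | linarith
  refine (Finset.sum_le_sum h).trans ?_
  rw [Finset.sum_add_distrib, Finset.sum_ite_mem, Finset.sum_ite_mem, Finset.sum_const,
    Finset.sum_const, nsmul_eq_mul, nsmul_eq_mul]
  have h1 : ((Finset.range m ∩ Finset.range p).card : ℝ) ≤ p := by
    have := Finset.card_le_card (Finset.inter_subset_right (s₁ := Finset.range m)
      (s₂ := Finset.range p))
    rw [Finset.card_range] at this
    exact_mod_cast this
  have h2 : ((Finset.range m ∩ Finset.Ico (m - p) m).card : ℝ) ≤ p := by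
    have := Finset.card_le_card (Finset.inter_subset_right (s₁ := Finset.range m)
      (s₂ := Finset.Ico (m - p) m))
    rw [Nat.card_Ico] at this
    have h' : (Finset.range m ∩ Finset.Ico (m - p) m).card ≤ p := by omega
    exact_mod_cast h'
  nlinarith

theorem abs_localDOS_pow_le (V : ℓ^∞(ℤ, ℝ)) (p : ℕ) (n : ℤ) :
    |localDOS V (fun x => x ^ p) n| ≤ (‖V‖ + 2) ^ p := by
  refine abs_localDOS_le V (by positivity) (fun x hx => ?_) n
  rw [abs_pow]
  exact pow_le_pow_left₀ (abs_nonneg x) (abs_le.2 hx) p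

/-- The eigenvalue moments of the windows `[a, a + m)` that exhaust `[0, N)` up to at most one
site at either end agree with the full-line moments up to a bounded error. -/
theorem exists_abs_moment_sub_le (V : ℓ^∞(ℤ, ℝ)) (p : ℕ) : ∃ C : ℝ, ∀ a m N : ℕ, a ≤ 1 →
    a + m ≤ N → N ≤ a + m + 1 →
    |∑ j, jacobiEigenvalues V a m j ^ p - ∑ n ∈ Finset.range N, localDOS V (fun x => x ^ p) n|
      ≤ C := by
  set Q : ℝ := (‖V‖ + 2) ^ p with hQ
  have hQ0 : 0 ≤ Q := by positivity
  set f : ℤ → ℝ := localDOS V (fun x => x ^ p) with hf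
  have hfQ : ∀ n, |f n| ≤ Q := abs_localDOS_pow_le V p
  -- At most `2 * p` boundary sites each contribute two terms of size `Q`, and at most two sites of
  -- `[0, N)` lie outside the window.
  refine ⟨2 * p * (2 * Q) + 2 * Q, fun a m N ha h1 h2 => ?_⟩
  have hwin : |∑ j, jacobiEigenvalues V a m j ^ p - ∑ i ∈ Finset.range m, f (a + i)| ≤
      2 * p * (2 * Q) := by
    rw [← trace_jacobi_pow, Matrix.trace, Finset.sum_range, ← Finset.sum_sub_distrib]
    refine (Finset.abs_sum_le_sum_abs _ _).trans ?_
    refine le_trans ?_ (sum_boundary_le m p (by positivity))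
    rw [Finset.sum_range]
    refine Finset.sum_le_sum fun i _ => ?_
    rw [Matrix.diag_apply]
    split_ifs with hi
    · have := jacobi_pow_apply_eq V a m p i hi.1 hi.2 i
      rw [hf]
      simp only [localDOS_pow]
      rw [← this, Complex.ofReal_re, sub_self, abs_zero]
    · refine (abs_sub _ _).trans ?_
      have := abs_jacobi_pow_apply_le (norm_nonneg V) (abs_potential_le V) a m p i i
      linarith [hfQ (a + i)]
  obtain ⟨b, rfl⟩ := Nat.exists_eq_add_of_le h1
  have hb : b ≤ 1 := by omega
  have hsmall : ∀ (c : ℕ) (t : ℕ → ℤ), c ≤ 1 → |∑ n ∈ Finset.range c, f (t n)| ≤ Q := by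
    intro c t hc
    interval_cases c
    · simpa using hQ0
    · simpa using hfQ _
  have e1 := hsmall a (fun n => n) ha
  have e2 := hsmall b (fun n => ((a + m + n : ℕ) : ℤ)) hb
  rw [Finset.sum_range_add, Finset.sum_range_add]
  push_cast at e2 ⊢
  rw [abs_le] at *
  constructor <;> linarith [hwin.1, hwin.2, e1.1, e1.2, e2.1, e2.2]

theorem exists_abs_polynomial_sub_le (V : ℓ^∞(ℤ, ℝ)) (P : Polynomial ℝ) : ∃ C : ℝ,
    ∀ a m N : ℕ, a ≤ 1 → a + m ≤ N → N ≤ a + m + 1 →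
    |∑ j, P.eval (jacobiEigenvalues V a m j) -
      ∑ n ∈ Finset.range N, localDOS V (fun x => P.eval x) n| ≤ C := by
  induction P using Polynomial.induction_on' with
  | add P R hP hR =>
    obtain ⟨C, hC⟩ := hP
    obtain ⟨D, hD⟩ := hR
    refine ⟨C + D, fun a m N h1 h2 h3 => ?_⟩
    have h4 := hC a m N h1 h2 h3
    have h5 := hD a m N h1 h2 h3
    simp only [Polynomial.eval_add, localDOS_add V P.continuous R.continuous,
      Finset.sum_add_distrib]
    rw [abs_le] at h4 h5 ⊢
    constructor <;> linarith [h4.1, h4.2, h5.1, h5.2]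
  | monomial p c =>
    obtain ⟨C, hC⟩ := exists_abs_moment_sub_le V p
    refine ⟨|c| * C, fun a m N h1 h2 h3 => ?_⟩
    simp only [Polynomial.eval_monomial, localDOS_const_mul V c (continuous_pow p)]
    rw [← Finset.mul_sum, ← Finset.mul_sum, ← mul_sub, abs_mul]
    exact mul_le_mul_of_nonneg_left (hC a m N h1 h2 h3) (abs_nonneg c)

/-- The eigenvalue distribution of the windows `[a, a + m)` approximates the averaged local
density of states. -/
theorem exists_abs_sum_eigenvalues_sub_le (V : ℓ^∞(ℤ, ℝ)) {g : ℝ → ℝ} (hg : Continuous g) {ε : ℝ}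
    (hε : 0 < ε) : ∃ C : ℝ, ∀ a m N : ℕ, a ≤ 1 → a + m ≤ N → N ≤ a + m + 1 →
    |∑ j, g (jacobiEigenvalues V a m j) - ∑ n ∈ Finset.range N, localDOS V g n| ≤ ε * N + C := by
  -- Weierstrass on an interval containing both the window eigenvalues and the spectrum of `H`; half
  -- of `ε` is spent on each.
  obtain ⟨P, hP⟩ := exists_polynomial_near_of_continuousOn (-(‖V‖ + 2)) (‖V‖ + 2) g
    hg.continuousOn (ε / 2) (by positivity)
  obtain ⟨C, hC⟩ := exists_abs_polynomial_sub_le V P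
  refine ⟨C, fun a m N h1 h2 h3 => ?_⟩
  have h4 := hC a m N h1 h2 h3
  have h5 : |∑ j, g (jacobiEigenvalues V a m j) - ∑ j, P.eval (jacobiEigenvalues V a m j)|
      ≤ ε / 2 * N := by
    rw [← Finset.sum_sub_distrib]
    refine (Finset.abs_sum_le_sum_abs _ _).trans ?_
    refine (Finset.sum_le_sum fun j _ => ?_).trans (b := ∑ j : Fin m, ε / 2) ?_
    · rw [abs_sub_comm]
      exact (hP _ (abs_le.1 (abs_jacobiEigenvalues_le (abs_potential_le V) a m j))).le
    · simp only [Finset.sum_const, Finset.card_univ, Fintype.card_fin, nsmul_eq_mul]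
      have : (m : ℝ) ≤ N := by exact_mod_cast (by omega : m ≤ N)
      nlinarith
  have h6 : |∑ n ∈ Finset.range N, localDOS V (fun x => P.eval x) n -
      ∑ n ∈ Finset.range N, localDOS V g n| ≤ ε / 2 * N := by
    rw [← Finset.sum_sub_distrib]
    refine (Finset.abs_sum_le_sum_abs _ _).trans ?_
    refine (Finset.sum_le_sum fun n _ => ?_).trans (b := ∑ n ∈ Finset.range N, ε / 2) ?_
    · have h7 : localDOS V (fun x => P.eval x) n =
          localDOS V g n + localDOS V (fun x => P.eval x - g x) n := by
        rw [← localDOS_add V (g := fun x => P.eval x - g x) hg (P.continuous.sub hg)]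
        simp only [add_sub_cancel]
      rw [h7, add_sub_cancel_left]
      exact abs_localDOS_le V (by positivity) (fun x hx => (hP x hx).le) n
    · simp [mul_comm]
  rw [abs_le] at *
  constructor <;> linarith [h4.1, h4.2, h5.1, h5.2, h6.1, h6.2]

/-! ### Log-Hölder continuity -/

/-- A continuous bump equal to `1` within distance `d / 2` of `E` and vanishing beyond
distance `d`. -/
def tent (E d : ℝ) : ℝ →ᵇ ℝ :=
  BoundedContinuousFunction.ofNormedAddCommGroup
    (fun x => max 0 (min 1 (2 - 2 * |x - E| / d))) (by fun_prop) 1 fun x => by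
      rw [Real.norm_eq_abs, abs_of_nonneg (le_max_left _ _)]
      exact max_le zero_le_one (min_le_left _ _)

theorem tent_apply (E d x : ℝ) : tent E d x = max 0 (min 1 (2 - 2 * |x - E| / d)) := rfl

theorem tent_nonneg (E d x : ℝ) : 0 ≤ tent E d x := le_max_left _ _

theorem tent_le_one (E d x : ℝ) : tent E d x ≤ 1 := max_le zero_le_one (min_le_left _ _)

theorem tent_eq_one {E d x : ℝ} (hd : 0 < d) (h : |x - E| ≤ d / 2) : tent E d x = 1 := by
  have : 2 * |x - E| / d ≤ 1 := by rw [div_le_one hd]; linarith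
  rw [tent_apply, min_eq_left (by linarith), max_eq_right zero_le_one]

theorem tent_eq_zero {E d x : ℝ} (hd : 0 < d) (h : d ≤ |x - E|) : tent E d x = 0 := by
  have : 2 ≤ 2 * |x - E| / d := by rw [le_div_iff₀ hd]; linarith
  rw [tent_apply, max_eq_left]
  exact (min_le_right _ _).trans (by linarith)

/-- Some window has few eigenvalues near `E`, because its characteristic determinant is not
small. -/
theorem exists_window_sum_tent_le (V : ℓ^∞(ℤ, ℝ)) (E : ℝ) {d : ℝ} (hd : 0 < d) (hd' : d ≤ 1 / 2)
    {N : ℕ} (hN : 2 ≤ N) : ∃ a m : ℕ, a ≤ 1 ∧ a + m ≤ N ∧ N ≤ a + m + 1 ∧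
      Real.log d⁻¹ * ∑ j, tent E d (jacobiEigenvalues V a m j) ≤
        N * Real.log (2 * ‖V‖ + 5) + Real.log 2 := by
  have hM : 0 ≤ Real.log (2 * ‖V‖ + 5) := Real.log_nonneg (by linarith [norm_nonneg V])
  obtain ⟨n, rfl⟩ := Nat.exists_eq_add_of_le' hN
  obtain ⟨a, m, ha, h1, h2, hdet⟩ := exists_half_le_abs_charDet V E n
  refine ⟨a, m, ha, h2, by omega, ?_⟩
  set lam := jacobiEigenvalues V a m with hlam
  have hbd : ∀ j, |lam j| ≤ ‖V‖ + 2 := abs_jacobiEigenvalues_le (abs_potential_le V) a m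
  rcases le_or_gt |E| (‖V‖ + 3) with hE | hE
  · rw [charDet_eq_prod, Finset.abs_prod] at hdet
    have hne : ∀ j, |E - lam j| ≠ 0 := by
      intro j hj
      rw [Finset.prod_eq_zero (Finset.mem_univ j) hj] at hdet
      norm_num at hdet
    -- The lower bound `1 / 2` on the determinant, in logarithmic form.
    have hlog : -Real.log 2 ≤ ∑ j, Real.log |E - lam j| := by
      rw [← Real.log_prod fun j _ => hne j, ← Real.log_inv]
      exact Real.log_le_log (by norm_num) (by linarith)
    -- If `|E - λ_j| < d`, then `log d⁻¹` is below `-log |E - λ_j|`. Otherwise the bump vanishes,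
    -- and `|E - λ_j| ≤ (‖V‖ + 3) + (‖V‖ + 2)` makes the right side nonnegative.
    have hterm : ∀ j, Real.log d⁻¹ * tent E d (lam j) ≤
        Real.log (2 * ‖V‖ + 5) - Real.log |E - lam j| := by
      intro j
      have hpos : 0 < |E - lam j| := lt_of_le_of_ne (abs_nonneg _) (hne j).symm
      rcases lt_or_ge |E - lam j| d with hj | hj
      · have hd1 : 0 ≤ Real.log d⁻¹ := by
          rw [Real.log_inv]; linarith [Real.log_nonpos hd.le (by linarith)]
        have h3 := mul_le_of_le_one_right hd1 (tent_le_one E d (lam j))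
        have h4 := Real.log_le_log hpos hj.le
        rw [Real.log_inv] at *
        linarith
      · rw [tent_eq_zero hd (by rwa [abs_sub_comm]), mul_zero, sub_nonneg]
        refine Real.log_le_log hpos ?_
        linarith [abs_sub E (lam j), hbd j]
    rw [Finset.mul_sum]
    refine (Finset.sum_le_sum fun j _ => hterm j).trans ?_
    rw [Finset.sum_sub_distrib, Finset.sum_const, Finset.card_univ, Fintype.card_fin, nsmul_eq_mul]
    have : (m : ℝ) ≤ (n + 2 : ℕ) := by exact_mod_cast (by omega : m ≤ n + 2)
    nlinarith
  -- Here `|E| > ‖V‖ + 3`, so every eigenvalue is more than `1 > d` away from `E`.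
  · rw [Finset.sum_eq_zero, mul_zero]
    · have := Real.log_nonneg (one_le_two (α := ℝ))
      positivity
    · intro j _
      refine tent_eq_zero hd ?_
      have := abs_sub_abs_le_abs_sub E (lam j)
      rw [abs_sub_comm]
      linarith [hbd j]

/-- Dividing the window estimate by `N` and letting `N → ∞` removes the bounded errors. The
approximation error is taken as `ε / L`, so that it costs `ε` after multiplication by `L = log d⁻¹`.
-/
theorem IsDensityOfStates.log_mul_integral_tent_le {V : ℓ^∞(ℤ, ℝ)} {κ : ProbabilityMeasure ℝ}
    (h : IsDensityOfStates V κ) (E : ℝ) {d : ℝ} (hd : 0 < d) (hd' : d ≤ 1 / 2) :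
    Real.log d⁻¹ * ∫ x, tent E d x ∂(κ : Measure ℝ) ≤ Real.log (2 * ‖V‖ + 5) := by
  have hL : 0 < Real.log d⁻¹ := Real.log_pos (by
    rw [one_lt_inv₀ hd]; linarith)
  set L := Real.log d⁻¹
  refine le_of_forall_pos_le_add fun ε hε => ?_
  obtain ⟨C, hC⟩ := exists_abs_sum_eigenvalues_sub_le V (tent E d).continuous
    (ε := ε / L) (by positivity)
  have hlim := ((isDensityOfStates_iff V κ).1 h (tent E d)).const_mul L
  have hrhs : Tendsto (fun N : ℕ => Real.log (2 * ‖V‖ + 5) + ε + (L * C + Real.log 2) / (N : ℝ))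
      atTop (𝓝 (Real.log (2 * ‖V‖ + 5) + ε + 0)) :=
    tendsto_const_nhds.add (tendsto_const_div_atTop_nhds_zero_nat _)
  rw [add_zero] at hrhs
  refine le_of_tendsto_of_tendsto hlim hrhs ?_
  filter_upwards [eventually_ge_atTop 2] with N hN
  have hN0 : (0 : ℝ) < N := by exact_mod_cast (by omega : 0 < N)
  obtain ⟨a, m, h1, h2, h3, h4⟩ := exists_window_sum_tent_le V E hd hd' hN
  have h5 := (abs_le.1 (hC a m N h1 h2 h3)).1
  have h6 : L * (∑ n ∈ Finset.range N, localDOS V (tent E d) n) ≤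
      L * ∑ j, tent E d (jacobiEigenvalues V a m j) + ε * N + L * C := by
    have : L * (∑ n ∈ Finset.range N, localDOS V (tent E d) n) ≤
        L * (∑ j, tent E d (jacobiEigenvalues V a m j) + (ε / L * N + C)) :=
      mul_le_mul_of_nonneg_left (by linarith) hL.le
    refine this.trans (le_of_eq ?_)
    field_simp
    ring
  rw [mul_div_assoc', div_le_iff₀ hN0, add_mul, div_mul_cancel₀ _ hN0.ne']
  linarith

theorem integrable_indicator_Iic (κ : ProbabilityMeasure ℝ) (E : ℝ) :
    Integrable ((Set.Iic E).indicator fun _ => (1 : ℝ)) (κ : Measure ℝ) :=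
  (integrable_const 1).indicator measurableSet_Iic

theorem integratedDOS_mono (κ : ProbabilityMeasure ℝ) : Monotone (integratedDOS κ) := by
  intro E₁ E₂ h
  refine integral_mono (integrable_indicator_Iic κ E₁) (integrable_indicator_Iic κ E₂) fun x => ?_
  exact Set.indicator_le_indicator_of_subset (Set.Iic_subset_Iic.2 h) (fun _ => zero_le_one) x

/-- The difference is the mass of `(E₁, E₂]`, which lies within half its length of the midpoint,
where the bump equals `1`. -/
theorem integratedDOS_sub_le (κ : ProbabilityMeasure ℝ) {E₁ E₂ : ℝ} (h : E₁ < E₂) :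
    integratedDOS κ E₂ - integratedDOS κ E₁ ≤
      ∫ x, tent ((E₁ + E₂) / 2) (E₂ - E₁) x ∂(κ : Measure ℝ) := by
  rw [integratedDOS, integratedDOS,
    ← integral_sub (integrable_indicator_Iic κ E₂) (integrable_indicator_Iic κ E₁)]
  refine integral_mono ((integrable_indicator_Iic κ E₂).sub (integrable_indicator_Iic κ E₁))
    (BoundedContinuousFunction.integrable _ _) fun x => ?_
  have h0 := tent_nonneg ((E₁ + E₂) / 2) (E₂ - E₁) x
  simp only [Set.indicator_apply, Set.mem_Iic]
  by_cases h1 : x ≤ E₁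
  · rw [if_pos h1, if_pos (h1.trans h.le), sub_self]
    exact h0
  · by_cases h2 : x ≤ E₂
    · rw [if_pos h2, if_neg h1, sub_zero, tent_eq_one (sub_pos.2 h)]
      rw [abs_le]
      constructor <;> linarith
    · rw [if_neg h1, if_neg h2, sub_self]
      exact h0

theorem IsDensityOfStates.logHolder {V : ℓ^∞(ℤ, ℝ)} {κ : ProbabilityMeasure ℝ}
    (h : IsDensityOfStates V κ) {E₁ E₂ : ℝ} (h₁₂ : |E₁ - E₂| ≤ 1 / 2) :
    |integratedDOS κ E₁ - integratedDOS κ E₂| ≤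
      Real.log (2 * ‖V‖ + 5) * (Real.log (|E₁ - E₂|⁻¹))⁻¹ := by
  wlog hlt : E₁ ≤ E₂ generalizing E₁ E₂
  · rw [abs_sub_comm, abs_sub_comm E₁]
    exact this (by rwa [abs_sub_comm]) (le_of_not_ge hlt)
  rcases hlt.eq_or_lt with rfl | hlt
  -- At equal energies `0⁻¹ = 0` and `log 0 = 0` make the right side `0`, as the convention
  -- requires.
  · simp
  · rw [abs_sub_comm, abs_sub_comm E₁, abs_of_pos (sub_pos.2 hlt),
      abs_of_nonneg (sub_nonneg.2 (integratedDOS_mono κ hlt.le))]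
    rw [abs_sub_comm, abs_of_pos (sub_pos.2 hlt)] at h₁₂
    have hd := sub_pos.2 hlt
    have hL : 0 < Real.log (E₂ - E₁)⁻¹ := Real.log_pos (by rw [one_lt_inv₀ hd]; linarith)
    rw [← div_eq_mul_inv, le_div_iff₀ hL]
    have h1 := h.log_mul_integral_tent_le ((E₁ + E₂) / 2) hd h₁₂
    have h2 := mul_le_mul_of_nonneg_left (integratedDOS_sub_le κ hlt) hL.le
    linarith

end AlmostPeriodicSchrodinger

end

/-- For an almost-periodic potential the density of states measure exists and is unique, and the
integrated density of states is log-Hölder continuous. -/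
theorem mainTheorem11 (V : ℓ^∞(ℤ, ℝ)) (hV : AlmostPeriodicSchrodinger.IsAlmostPeriodic V) :
    (∃! κ : ProbabilityMeasure ℝ, AlmostPeriodicSchrodinger.IsDensityOfStates V κ) ∧
      ∀ κ : ProbabilityMeasure ℝ, AlmostPeriodicSchrodinger.IsDensityOfStates V κ →
        ∃ C : ℝ, 0 < C ∧ ∀ E₁ E₂ : ℝ, |E₁ - E₂| ≤ 1 / 2 →
          |AlmostPeriodicSchrodinger.integratedDOS κ E₁ -
              AlmostPeriodicSchrodinger.integratedDOS κ E₂|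
            ≤ C * (Real.log (|E₁ - E₂|⁻¹))⁻¹ := by
  constructor
  · obtain ⟨κ, hκ⟩ := AlmostPeriodicSchrodinger.exists_isDensityOfStates hV
    exact ⟨κ, hκ, fun κ' hκ' => hκ'.eq hκ⟩
  · intro κ hκ
    exact ⟨Real.log (2 * ‖V‖ + 5), Real.log_pos (by linarith [norm_nonneg V]),
      fun E₁ E₂ h => hκ.logHolder h⟩
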